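/- Notation. $\mathbb N=\{1,2,\dots\}$, and $[0,1]^d$ carries Lebesgue measure. A ReLU neural network $\psi=((A_1,b_1),\dots,(A_L,b_L))$, with matrices $A_j\in\mathbb R^{d_j\times d_{j-1}}$ and vectors $b_j\in\mathbb R^{d_j}$, has depth $L(\psi)=L$, number of weights $W(\psi)$ equal to the total number of nonzero entries of all $A_j,b_j$, and $\|\psi\|_{\mathsf{NN}}$ equal to the largest absolute value of an entry of the $A_j,b_j$. It realizes the function $T_L\circ(\sigma\circ T_{L-1})\circ\cdots\circ(\sigma\circ T_1)$, where $T_jx=A_jx+b_j$ and $\sigma=\max\{0,\cdot\}$ acts componentwise. For $\ell:\mathbb N\to\mathbb N\cup\{\infty\}$ non-decreasing, let $\Sigma^{\ell}_{d,n}$ be the set of functions $\mathbb R^d\to\mathbb R$ realized by such networks with $W(\psi)\le n$, $L(\psi)\le\ell(n)$ and $\|\psi\|_{\mathsf{NN}}\le1$, and let $\ell^*:=\sup_n\ell(n)$. For $\alpha\in(0,\infty)$ and $f\in L^\infty(\mathbb R^d)$ put $$\Gamma(f):=\max\Big\{\|f\|_{L^\infty(\mathbb R^d)},\ \sup_{n\in\mathbb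 N} n^{\alpha}\inf_{g\in\Sigma^{\ell}_{d,n}}\|f-g\|_{L^\infty(\mathbb R^d)}\Big\},\qquad \|f\|_{A^{\alpha,\infty}_\ell}:=\inf\{\theta>0:\Gamma(f/\theta)\le1\},$$ and let $U^{\alpha,\infty}_\ell(\mathbb R^d)$ be the set of $f\in L^\infty(\mathbb R^d)$ with $\|f\|_{A^{\alpha,\infty}_\ell}\le1$. For $D=[0,1]^d$, $U\subset C(D)$ and $p\in[1,\infty]$, a deterministic method using $N$ point measurements is a map $A:U\to L^p(D)$ of the form $A(f)=Q(f(x_1),\dots,f(x_N))$ with $x_1,\dots,x_N\in D$ and an arbitrary map $Q:\mathbb R^N\to L^p(D)$ (a constant map if $N=0$). A randomized method using $N$ point measurements in expectation consists of a probability space $(\Omega,\mathcal F,\mathbb P)$, a measurable $\mathsf N:\Omega\to\mathbb N\cup\{0\}$ with $\mathbb E[\mathsf N]\le N$, and maps $A_\omega:U\to L^p(D)$, $\omega\in\Omega$, such that each $A_\omega$ is a deterministic method using $\mathsf N(\omega)$ point measurements, $\omega\mapsto A_\omega(f)$ is measurable for each $f\in U$, and $(\omega,f)\mapsto A_\omega(f)$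 is measurable on $\Omega\times U$ (with the Borel $\sigma$-algebras of the uniform norm on $U$ and of the norm on $L^p(D)$). Let $$e_N(U,L^p(D)):=\inf_{(A,\mathsf N)}\ \sup_{f\in U}\mathbb E_\omega\big[\|f-A_\omega(f)\|_{L^p(D)}\big],$$ with the infimum over all such methods, and $$\beta_*(U,L^p(D)):=\sup\{\beta\ge0:\ \exists C>0\ \forall N\in\mathbb N:\ e_N(U,L^p(D))\le C N^{-\beta}\}.$$ Theorem. Let $p\in[1,\infty]$, let $\ell:\mathbb N\to\mathbb N\cup\{\infty\}$ be non-decreasing with $\ell^*\ge3$, let $d\in\mathbb N$ and $\alpha\in(0,\infty)$. Then the restriction to $[0,1]^d$ of every $f\in U^{\alpha,\infty}_\ell(\mathbb R^d)$ agrees almost everywhere with a continuous function, so that $U:=\{f|_{[0,1]^d}: f\in U^{\alpha,\infty}_\ell(\mathbb R^d)\}$ is a subset of $C([0,1]^d)$, and $$\beta_*\big(U,L^p([0,1]^d)\big)\ \le\ \frac1p+\frac1d\cdot\frac{\alpha}{\alpha+\lfloor \ell^*/2\rfloor},$$ where $1/\infty=0$, and the last fraction is read as $0$ if $\ell^*=\infty$.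 -/

import Mathlib

universe u

open MeasureTheory
open scoped NNReal ENNReal

noncomputable section

namespace SamplingGap

/-! ### ReLU neural networks -/

/-- A neural network with input dimension `m` and output dimension `n`: a nonempty list
`((A₁, b₁), …, (A_L, b_L))` of matrices and bias vectors of compatible sizes. -/
inductive Network : ℕ → ℕ → Type
  | last {m n : ℕ} (A : Matrix (Fin n) (Fin m) ℝ) (b : Fin n → ℝ) : Network m n
  | cons {m k n : ℕ} (A : Matrix (Fin k) (Fin m) ℝ) (b : Fin k → ℝ) (rest : Network k n) :
      Network m n

namespace Network

/-- The number of layers `L`. -/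
def depth : {m n : ℕ} → Network m n → ℕ
  | _, _, last _ _ => 1
  | _, _, cons _ _ rest => rest.depth + 1

/-- The number of nonzero entries of one layer `(A, b)`. -/
def layerWeights {m k : ℕ} (A : Matrix (Fin k) (Fin m) ℝ) (b : Fin k → ℝ) : ℕ :=
  (Finset.univ.filter fun q : Fin k × Fin m => A q.1 q.2 ≠ 0).card +
    (Finset.univ.filter fun i : Fin k => b i ≠ 0).card

/-- The number `W` of nonzero weights and biases. -/
def numWeights : {m n : ℕ} → Network m n → ℕ
  | _, _, last A b => layerWeights A b
  | _, _, cons A b rest => layerWeights A b + rest.numWeights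

/-- The largest absolute value of an entry of one layer `(A, b)`. -/
def layerNorm {m k : ℕ} (A : Matrix (Fin k) (Fin m) ℝ) (b : Fin k → ℝ) : ℝ≥0 :=
  max (Finset.univ.sup fun q : Fin k × Fin m => ‖A q.1 q.2‖₊)
    (Finset.univ.sup fun i : Fin k => ‖b i‖₊)

/-- The largest absolute value of a weight or bias. -/
def maxNorm : {m n : ℕ} → Network m n → ℝ≥0
  | _, _, last A b => layerNorm A b
  | _, _, cons A b rest => max (layerNorm A b) rest.maxNorm

/-- The ReLU realization `T_L ∘ (σ ∘ T_{L-1}) ∘ ⋯ ∘ (σ ∘ T₁)`, where `T_j x = A_j x + b_j` and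
`σ = max 0 ·` acts componentwise. -/
def realize : {m n : ℕ} → Network m n → (Fin m → ℝ) → (Fin n → ℝ)
  | _, _, last A b, x => A.mulVec x + b
  | _, _, cons A b rest, x => rest.realize fun i => max 0 ((A.mulVec x + b) i)

end Network

/-! ### Approximation spaces -/

/-- `Σ_{d,n}^ℓ`: the functions `ℝ^d → ℝ` realized by ReLU networks with at most `n` nonzero
weights, depth at most `ℓ n`, and weights of magnitude at most `1`. -/
def netClass (d : ℕ) (l : ℕ+ → ℕ∞) (n : ℕ+) : Set ((Fin d → ℝ) → ℝ) :=
  {g | ∃ ψ : Network d 1, ψ.numWeights ≤ (n : ℕ) ∧ (ψ.depth : ℕ∞) ≤ l n ∧ ψ.maxNorm ≤ 1 ∧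
    g = fun x => ψ.realize x 0}

/-- The `L^p(D)`-distance of `f` to a set of functions. -/
def lpDist {d : ℕ} (p : ℝ≥0∞) (D : Set (Fin d → ℝ)) (f : (Fin d → ℝ) → ℝ)
    (S : Set ((Fin d → ℝ) → ℝ)) : ℝ≥0∞ :=
  ⨅ g ∈ S, eLpNorm (fun x => f x - g x) p (volume.restrict D)

/-- The functional `Γ^{α,p}`. Functions on `D` are represented by functions on `ℝ^d`, whose values
off `D` do not matter. -/
def gammaFun {d : ℕ} (l : ℕ+ → ℕ∞) (α : ℝ) (p : ℝ≥0∞) (D : Set (Fin d → ℝ))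
    (f : (Fin d → ℝ) → ℝ) : ℝ≥0∞ :=
  max (eLpNorm f p (volume.restrict D))
    (⨆ n : ℕ+, ((n : ℕ) : ℝ≥0∞) ^ α * lpDist p D f (netClass d l n))

/-- The approximation space quasi-norm `inf {θ > 0 : Γ^{α,p}(f / θ) ≤ 1}`. -/
def quasiNorm {d : ℕ} (l : ℕ+ → ℕ∞) (α : ℝ) (p : ℝ≥0∞) (D : Set (Fin d → ℝ))
    (f : (Fin d → ℝ) → ℝ) : ℝ≥0∞ :=
  ⨅ (θ : ℝ≥0) (_ : 0 < θ) (_ : gammaFun l α p D (fun x => f x / (θ : ℝ)) ≤ 1), (θ : ℝ≥0∞)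

/-- The unit ball `U_ℓ^{α,p}(D)` of the approximation space `A_ℓ^{α,p}(D)`. -/
def unitBall {d : ℕ} (l : ℕ+ → ℕ∞) (α : ℝ) (p : ℝ≥0∞) (D : Set (Fin d → ℝ)) :
    Set ((Fin d → ℝ) → ℝ) :=
  {f | MemLp f p (volume.restrict D) ∧ quasiNorm l α p D f ≤ 1}

/-- The unit cube `[0,1]^d`. -/
abbrev cube (d : ℕ) : Set (Fin d → ℝ) := Set.Icc 0 1

/-- Lebesgue measure on a subset of `ℝ^d`, regarded as a space of its own. -/
abbrev leb {d : ℕ} (D : Set (Fin d → ℝ)) : Measure D := Measure.comap Subtype.val volume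

/-- `U_ℓ^{α,∞}(ℝ^d)|_{[0,1]^d}` as a set of continuous functions on the cube. The elements of
`U_ℓ^{α,∞}(ℝ^d)` are `L^∞`-classes, so the restriction of `f` is identified with the continuous
function on the cube that agrees with it almost everywhere. -/
def restrictedBall (d : ℕ) (l : ℕ+ → ℕ∞) (α : ℝ) : Set C(cube d, ℝ) :=
  {h | ∃ f ∈ unitBall l α ∞ (Set.univ : Set (Fin d → ℝ)),
    ∀ᵐ x ∂leb (cube d), h x = f (x : Fin d → ℝ)}

/-! ### Randomized sampling complexity, for a compact domain `D` -/

variable {d : ℕ} {D : Set (Fin d → ℝ)}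

/-- `A : U → L^p(D)` is a deterministic method using `N` point measurements. -/
def IsDeterministicMethod (U : Set C(D, ℝ)) (p : ℝ≥0∞) (N : ℕ)
    (A : U → Lp ℝ p (leb D)) : Prop :=
  ∃ (x : Fin N → D) (Q : (Fin N → ℝ) → Lp ℝ p (leb D)),
    ∀ f : U, A f = Q fun i => (f : C(D, ℝ)) (x i)

/-- A strongly measurable randomized method using `N` point measurements in expectation.
For compact `D` the topology of `C(D, ℝ)` is that of the uniform norm. -/
structure RandomizedMethod [CompactSpace D] (U : Set C(D, ℝ)) (p : ℝ≥0∞) [Fact (1 ≤ p)]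
    (N : ℕ) where
  /-- the sample space -/
  Ω : Type u
  [mΩ : MeasurableSpace Ω]
  /-- the probability measure -/
  P : Measure Ω
  [isProb : IsProbabilityMeasure P]
  /-- the random reconstruction map -/
  A : Ω → U → Lp ℝ p (leb D)
  /-- the random number of point measurements -/
  numSamples : Ω → ℕ
  measurable_numSamples : Measurable numSamples
  measurable_apply : ∀ f : U, @Measurable Ω (Lp ℝ p (leb D)) mΩ (borel _)
    fun ω => A ω f
  deterministic : ∀ ω, IsDeterministicMethod U p (numSamples ω) (A ω)
  expected_numSamples : ∫⁻ ω, (numSamples ω : ℝ≥0∞) ∂P ≤ (N : ℝ≥0∞)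
  strongly_measurable : @Measurable (Ω × U) (Lp ℝ p (leb D))
    (@Prod.instMeasurableSpace Ω U mΩ (borel U)) (borel _) fun z => A z.1 z.2

/-- The expected error `sup_{f ∈ U} 𝔼_ω ‖f - A_ω(f)‖_{L^p(D)}`. -/
def RandomizedMethod.error [CompactSpace D] {U : Set C(D, ℝ)} {p : ℝ≥0∞} [Fact (1 ≤ p)] {N : ℕ}
    (S : RandomizedMethod.{u} U p N) : ℝ≥0∞ :=
  letI := S.mΩ
  ⨆ f : U, ∫⁻ ω, eLpNorm (fun x : D => (f : C(D, ℝ)) x - S.A ω f x) p (leb D) ∂S.P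

/-- The optimal randomized error `e_N^ran(U, L^p(D))`. -/
def optimalError [CompactSpace D] (U : Set C(D, ℝ)) (p : ℝ≥0∞) [Fact (1 ≤ p)] (N : ℕ) : ℝ≥0∞ :=
  ⨅ S : RandomizedMethod.{u} U p N, S.error

/-- The optimal randomized order `β_*(U, L^p(D)) ∈ [0, ∞]`. -/
def optimalOrder [CompactSpace D] (U : Set C(D, ℝ)) (p : ℝ≥0∞) [Fact (1 ≤ p)] : ℝ≥0∞ :=
  ⨆ (β : ℝ≥0) (_ : ∃ C : ℝ≥0, 0 < C ∧ ∀ N : ℕ, 1 ≤ N →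
    optimalError.{u} U p N ≤ (C : ℝ≥0∞) * (N : ℝ≥0∞) ^ (-(β : ℝ))), (β : ℝ≥0∞)

/-- `⌊k / 2⌋` for `k ∈ ℕ ∪ {∞}`, with `⌊∞ / 2⌋ = ∞`, as an extended nonnegative real. -/
def halfFloor (k : ℕ∞) : ℝ≥0∞ :=
  if k = ⊤ then ∞ else ((k.toNat / 2 : ℕ) : ℝ≥0∞)

end SamplingGap

end

/-!
Continuity of the representatives is immediate: a function in the unit ball is approximated in
`L^∞(ℝ^d)` by network realizations, which are continuous, so the approximants are uniformly Cauchy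
on all of `ℝ^d` and their limit is continuous (`exists_continuous_ae_eq_of_mem_unitBall`).

The bound on the order rests on spikes `x ↦ max 0 (κ - s * ‖x - y‖₁)` that are steep although all
weights are at most `1`. Copying a scalar `n` times and adding up the copies multiplies it by `n`
at the price of two layers and `2 * n` weights. Two layers also suffice to form
`max 0 (κ' - n * ‖x - y‖₁)` from `O(n)` weights, so a network of depth `max 3 (2 * k)` with at most
`c * n` weights realizes the spike of slope `s = n ^ k` and height `κ` (`spikeNetwork`). With
`κ = (c * n) ^ (-α)` this spike lies in the unit ball (`cubeSpike_mem_restrictedBall`): the zero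
network is a sufficiently good approximation when fewer than `c * n` weights are allowed, and the
approximation is exact otherwise.

The support of the spike has diameter of order `κ / s`, i.e. `n ^ (-(α + k))`, so the cube holds
about `n ^ (d * (α + k))` of them with disjoint supports. A method using half as many samples in
expectation misses at least half of the spikes on average and returns for those the same answer as
for the zero function, so its error is at least a quarter of the `L^p`-norm of a spike
(`le_four_mul_optimalError`); averaging over the spikes is what makes this work for random methods.
That norm is of order `κ * (κ / s) ^ (d / p)` (`le_eLpNorm_cubeSpike`). Comparing exponents of `n`
gives `β ≤ 1 / p + α / (d * (α + k))` (`order_le_of_depth`). The value `k = ⌊ℓ* / 2⌋` is admissible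
if `ℓ*` is finite, since then `max 3 (2 * k) ≤ ℓ*`; if `ℓ* = ∞`, every `k` is, and `k → ∞`.
-/

namespace SamplingGap

/-! ### Networks that amplify -/

namespace Network

theorem continuous_realize {m n : ℕ} (ψ : Network m n) : Continuous ψ.realize := by
  induction ψ with
  | last A b =>
    simp only [realize]
    fun_prop
  | cons A b rest ih =>
    simp only [realize]
    refine ih.comp (continuous_pi fun i => continuous_const.max ?_)
    fun_prop

theorem layerNorm_le_one {m k : ℕ} {A : Matrix (Fin k) (Fin m) ℝ} {b : Fin k → ℝ}
    (hA : ∀ i j, |A i j| ≤ 1) (hb : ∀ i, |b i| ≤ 1) : layerNorm A b ≤ 1 := by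
  refine max_le (Finset.sup_le fun q _ => ?_) (Finset.sup_le fun i _ => ?_)
  · exact_mod_cast hA q.1 q.2
  · exact_mod_cast hb i

theorem layerWeights_le_mul_add {m k : ℕ} (A : Matrix (Fin k) (Fin m) ℝ) (b : Fin k → ℝ) :
    layerWeights A b ≤ k * m + k := by
  unfold layerWeights
  gcongr
  · exact (Finset.card_le_univ _).trans (by simp)
  · exact (Finset.card_le_univ _).trans (by simp)

theorem layerWeights_zero_bias_le {m k : ℕ} (A : Matrix (Fin k) (Fin m) ℝ) :
    layerWeights A 0 ≤ k * m := by
  unfold layerWeights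
  simpa using Finset.card_le_univ (Finset.univ.filter fun q : Fin k × Fin m => A q.1 q.2 ≠ 0)

/-- A layer each of whose rows reads a single input coordinate has at most two nonzero entries
per row. -/
theorem layerWeights_le_of_row_support {m k : ℕ} {A : Matrix (Fin k) (Fin m) ℝ} (b : Fin k → ℝ)
    (s : Fin k → Fin m) (hA : ∀ i j, j ≠ s i → A i j = 0) : layerWeights A b ≤ 2 * k := by
  unfold layerWeights
  rw [two_mul]
  gcongr
  · calc _ ≤ (Finset.univ.image fun i : Fin k => (i, s i)).card := by
          refine Finset.card_le_card fun q hq => ?_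
          simp only [Finset.mem_filter, Finset.mem_univ, true_and] at hq
          simp only [Finset.mem_image, Finset.mem_univ, true_and]
          exact ⟨q.1, Prod.ext rfl (by by_contra h; exact hq (hA _ _ (Ne.symm h)))⟩
      _ ≤ _ := Finset.card_image_le.trans (by simp)
  · exact (Finset.card_le_univ _).trans (by simp)

/-- A network computing `t ↦ n ^ j * t` for `t ≥ 0`. Each factor `n` takes two layers, which copy
the input `n` times and add up the copies. -/
def amplifier (n : ℕ) : ℕ → Network 1 1
  | 0 => last (.of 1) 0
  | 1 => cons (.of 1 : Matrix (Fin n) (Fin 1) ℝ) 0 (last (.of 1) 0)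
  | j + 2 => cons (.of 1 : Matrix (Fin n) (Fin 1) ℝ) 0 (cons (.of 1) 0 (amplifier n (j + 1)))

theorem realize_amplifier (n j : ℕ) {t : ℝ} (ht : 0 ≤ t) :
    (amplifier n j).realize (fun _ => t) 0 = n ^ j * t := by
  induction j using amplifier.induct generalizing t with
  | case1 => simp [amplifier, realize, Matrix.mulVec, dotProduct]
  | case2 => simp [amplifier, realize, Matrix.mulVec, dotProduct, ht]
  | case3 j ih =>
    have h : (0 : ℝ) ≤ n * t := by positivity
    rw [amplifier, realize, realize]
    simp only [Matrix.mulVec, dotProduct, Matrix.of_apply, Pi.one_apply, Pi.add_apply,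
      Pi.zero_apply, one_mul, add_zero, Finset.sum_const, Finset.card_univ, Fintype.card_fin,
      one_smul, nsmul_eq_mul, max_eq_right ht, max_eq_right h]
    rw [ih h, Nat.succ_eq_add_one]
    ring

theorem numWeights_amplifier_le (n j : ℕ) : (amplifier n j).numWeights ≤ 2 * j * n + 1 := by
  induction j using amplifier.induct with
  | case1 => exact (layerWeights_zero_bias_le _).trans (by simp)
  | case2 =>
    simp only [amplifier, numWeights]
    have h₁ := layerWeights_zero_bias_le (.of 1 : Matrix (Fin n) (Fin 1) ℝ)
    have h₂ := layerWeights_zero_bias_le (.of 1 : Matrix (Fin 1) (Fin n) ℝ)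
    linarith
  | case3 j ih =>
    simp only [amplifier, numWeights]
    have h₁ := layerWeights_zero_bias_le (.of 1 : Matrix (Fin n) (Fin 1) ℝ)
    have h₂ := layerWeights_zero_bias_le (.of 1 : Matrix (Fin 1) (Fin n) ℝ)
    linarith

theorem depth_amplifier_le (n j : ℕ) : (amplifier n j).depth ≤ max 1 (2 * j) := by
  induction j using amplifier.induct with
  | case1 => simp [amplifier, depth]
  | case2 => simp [amplifier, depth]
  | case3 j ih =>
    simp only [amplifier, depth]
    omega

theorem maxNorm_amplifier_le (n j : ℕ) : (amplifier n j).maxNorm ≤ 1 := by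
  have h {m k : ℕ} : layerNorm (.of 1 : Matrix (Fin k) (Fin m) ℝ) 0 ≤ 1 :=
    layerNorm_le_one (by simp) (by simp)
  induction j using amplifier.induct with
  | case1 => exact h
  | case2 => exact max_le h h
  | case3 j ih => exact max_le h (max_le h ih)

end Network

/-! ### Spikes realized by small networks -/

/-- The spike of height `κ` centred at `y`, with slope `s` in the `ℓ¹`-norm. -/
noncomputable def spike {d : ℕ} (κ s : ℝ) (y x : Fin d → ℝ) : ℝ :=
  max 0 (κ - s * ∑ i, |x i - y i|)

/-- The row index type of the first layer of `spikeNetwork`: `n` copies of the positive and the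
negative part of each coordinate of `x - y`. -/
abbrev SpikeRow (d n : ℕ) : Type := Fin n × Fin d × Bool

/-- The enumeration of the rows of the first layer of `spikeNetwork`. -/
noncomputable def spikeRow (d n : ℕ) : Fin (Fintype.card (SpikeRow d n)) ≃ SpikeRow d n :=
  (Fintype.equivFin _).symm

/-- A network for the spike of height `κ` and slope `n ^ (j + 1)` centred at `y`: two layers
compute `max 0 (κ / n ^ j - n * ‖x - y‖₁)`, which is then amplified by `n ^ j`. -/
noncomputable def spikeNetwork {d : ℕ} (n j : ℕ) (κ : ℝ) (y : Fin d → ℝ) : Network d 1 :=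
  .cons (fun q i => if i = (spikeRow d n q).2.1 then (bif (spikeRow d n q).2.2 then 1 else -1)
      else 0)
    (fun q => (bif (spikeRow d n q).2.2 then -1 else 1) * y (spikeRow d n q).2.1)
    (.cons (fun _ _ => -1) (fun _ => κ / n ^ j) (Network.amplifier n j))

theorem realize_spikeNetwork {d n : ℕ} (hn : 0 < n) (j : ℕ) (κ : ℝ) (y x : Fin d → ℝ) :
    (spikeNetwork n j κ y).realize x 0 = spike κ (n ^ (j + 1)) y x := by
  have hn' : (0 : ℝ) < n := by exact_mod_cast hn
  have habs (i : Fin d) : max 0 (x i - y i) + max 0 (-x i + y i) = |x i - y i| := by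
    rcases le_total (x i) (y i) with h | h
    · rw [max_eq_left (by linarith), max_eq_right (by linarith), abs_of_nonpos (by linarith)]
      ring
    · rw [max_eq_right (by linarith), max_eq_left (by linarith), abs_of_nonneg (by linarith)]
      ring
  have hsum : ∑ q, max 0 ((bif (spikeRow d n q).2.2 then (1 : ℝ) else -1) *
      x (spikeRow d n q).2.1 +
      (bif (spikeRow d n q).2.2 then (-1 : ℝ) else 1) * y (spikeRow d n q).2.1) =
        n * ∑ i, |x i - y i| := by
    rw [(spikeRow d n).sum_comp fun q => max 0 ((bif q.2.2 then (1 : ℝ) else -1) * x q.2.1 +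
      (bif q.2.2 then (-1 : ℝ) else 1) * y q.2.1)]
    simp only [Fintype.sum_prod_type, Fintype.sum_bool, cond_true, cond_false, one_mul, neg_mul,
      ← sub_eq_add_neg]
    simp [habs]
  simp only [spikeNetwork, Network.realize, Matrix.mulVec, dotProduct, Pi.add_apply, ite_mul,
    zero_mul, Finset.sum_ite_eq', Finset.mem_univ, if_true, neg_mul, one_mul,
    Finset.sum_neg_distrib] at hsum ⊢
  rw [hsum, Network.realize_amplifier _ _ (le_max_left _ _), spike,
    mul_max_of_nonneg _ _ (by positivity), mul_zero]
  congr 1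
  field_simp
  ring

theorem numWeights_spikeNetwork_le {d n : ℕ} (hn : 0 < n) (j : ℕ) (κ : ℝ) (y : Fin d → ℝ) :
    (spikeNetwork n j κ y).numWeights ≤ (6 * d + 2 * (j + 1)) * n := by
  simp only [spikeNetwork, Network.numWeights]
  refine (add_le_add (Network.layerWeights_le_of_row_support _
    (fun q => (spikeRow d n q).2.1) fun i j h => if_neg h)
    (add_le_add (Network.layerWeights_le_mul_add _ _) (Network.numWeights_amplifier_le n j))).trans
    ?_
  simp only [Fintype.card_prod, Fintype.card_fin, Fintype.card_bool]
  nlinarith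

theorem depth_spikeNetwork_le {d : ℕ} (n j : ℕ) (κ : ℝ) (y : Fin d → ℝ) :
    (spikeNetwork n j κ y).depth ≤ max 3 (2 * (j + 1)) := by
  have := Network.depth_amplifier_le n j
  simp only [spikeNetwork, Network.depth]
  omega

theorem maxNorm_spikeNetwork_le {d n : ℕ} (hn : 0 < n) (j : ℕ) {κ : ℝ} (h₀ : 0 ≤ κ) (h₁ : κ ≤ 1)
    {y : Fin d → ℝ} (hy : y ∈ cube d) : (spikeNetwork n j κ y).maxNorm ≤ 1 := by
  have hn' : (1 : ℝ) ≤ n := by exact_mod_cast hn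
  refine max_le (Network.layerNorm_le_one (fun q i => ?_) fun q => ?_)
    (max_le (Network.layerNorm_le_one (by simp) fun _ => ?_) (Network.maxNorm_amplifier_le n j))
  · cases (spikeRow d n q).2.2 <;> split_ifs <;> simp
  · have hy₀ : 0 ≤ y (spikeRow d n q).2.1 := hy.1 _
    have h : |y (spikeRow d n q).2.1| ≤ 1 := by
      rw [abs_of_nonneg hy₀]
      exact hy.2 _
    cases (spikeRow d n q).2.2 <;> simpa using h
  · rw [abs_of_nonneg (by positivity)]
    exact div_le_one_of_le₀ (h₁.trans (one_le_pow₀ hn')) (by positivity)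

theorem spike_mem_netClass {d n j : ℕ} {l : ℕ+ → ℕ∞} {κ : ℝ} (hn : 0 < n) (h₀ : 0 ≤ κ)
    (h₁ : κ ≤ 1) {y : Fin d → ℝ} (hy : y ∈ cube d) {m : ℕ+}
    (hm : (6 * d + 2 * (j + 1)) * n ≤ m) (hl : ((max 3 (2 * (j + 1)) : ℕ) : ℕ∞) ≤ l m) :
    spike κ (n ^ (j + 1)) y ∈ netClass d l m :=
  ⟨spikeNetwork n j κ y, (numWeights_spikeNetwork_le hn j κ y).trans hm,
    le_trans (by exact_mod_cast depth_spikeNetwork_le n j κ y) hl,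
    maxNorm_spikeNetwork_le hn j h₀ h₁ hy, funext fun x => (realize_spikeNetwork hn j κ y x).symm⟩

theorem zero_mem_netClass {d : ℕ} {l : ℕ+ → ℕ∞} {n : ℕ+} (hl : 1 ≤ l n) :
    (fun _ => 0) ∈ netClass d l n :=
  ⟨.last 0 0, by simp [Network.numWeights, Network.layerWeights], by simpa [Network.depth] using hl,
    Network.layerNorm_le_one (by simp) (by simp), by funext x; simp [Network.realize]⟩

theorem continuous_of_mem_netClass {d : ℕ} {l : ℕ+ → ℕ∞} {n : ℕ+} {g : (Fin d → ℝ) → ℝ}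
    (hg : g ∈ netClass d l n) : Continuous g := by
  obtain ⟨ψ, -, -, -, rfl⟩ := hg
  exact (continuous_apply 0).comp ψ.continuous_realize

/-! ### Continuous representatives -/

theorem ae_leb_of_ae {d : ℕ} {D : Set (Fin d → ℝ)} (hD : MeasurableSet D)
    {P : (Fin d → ℝ) → Prop} (h : ∀ᵐ x, P x) : ∀ᵐ x : D ∂leb D, P x :=
  (ae_restrict_iff_subtype hD).1 (ae_restrict_of_ae h)

/-- Every function in the unit ball is, up to a null set, a uniform limit of network realizations,
hence continuous. -/
theorem exists_continuous_ae_eq_of_mem_unitBall {d : ℕ} {l : ℕ+ → ℕ∞} {α : ℝ} (hα : 0 < α)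
    {f : (Fin d → ℝ) → ℝ} (hf : f ∈ unitBall l α ∞ Set.univ) :
    ∃ g : (Fin d → ℝ) → ℝ, Continuous g ∧ f =ᵐ[volume] g := by
  have hlt : quasiNorm l α ∞ Set.univ f < 2 := hf.2.trans_lt (by norm_num)
  simp only [quasiNorm, iInf_lt_iff] at hlt
  obtain ⟨θ, hθ, hΓ, -⟩ := hlt
  have hθ' : (θ : ℝ) ≠ 0 := by exact_mod_cast hθ.ne'
  have hdist (n : ℕ) : lpDist ∞ Set.univ (fun x => f x / (θ : ℝ)) (netClass d l n.succPNat) <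
      ENNReal.ofReal (2 * ((n : ℝ) + 1) ^ (-α)) := by
    have h := (le_iSup (fun n : ℕ+ => ((n : ℕ) : ℝ≥0∞) ^ α *
      lpDist ∞ Set.univ (fun x => f x / (θ : ℝ)) (netClass d l n)) n.succPNat).trans
        ((le_max_right _ _).trans hΓ)
    have hn : (0 : ℝ) < (n : ℝ) + 1 := by positivity
    have hc : ((n.succPNat : ℕ) : ℝ≥0∞) ^ α = ENNReal.ofReal (((n : ℝ) + 1) ^ α) := by
      rw [← ENNReal.ofReal_rpow_of_pos hn]
      congr 1
      rw [Nat.succPNat_coe, ← ENNReal.ofReal_natCast]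
      simp
    simp only [hc] at h
    have hpos : 0 < ((n : ℝ) + 1) ^ α := by positivity
    have hpos' : ENNReal.ofReal (((n : ℝ) + 1) ^ α) ≠ 0 := (ENNReal.ofReal_pos.2 hpos).ne'
    rw [mul_comm] at h
    refine ((ENNReal.le_div_iff_mul_le (.inl hpos') (.inl ENNReal.ofReal_ne_top)).2
      h).trans_lt ?_
    rw [one_div, ← ENNReal.ofReal_inv_of_pos hpos, Real.rpow_neg hn.le]
    exact (ENNReal.ofReal_lt_ofReal_iff (by positivity)).2 (by
      have : 0 < (((n : ℝ) + 1) ^ α)⁻¹ := by positivity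
      linarith)
  simp only [lpDist, iInf_lt_iff] at hdist
  choose g hg hfg using hdist
  have hgc (n : ℕ) : Continuous (g n) := continuous_of_mem_netClass (hg n)
  set ε : ℕ → ℝ := fun n => 2 * ((n : ℝ) + 1) ^ (-α)
  have hε : Filter.Tendsto ε Filter.atTop (nhds 0) := by
    have h := (tendsto_rpow_neg_atTop hα).comp
      (Filter.tendsto_atTop_add_const_right _ (1 : ℝ) tendsto_natCast_atTop_atTop)
    simpa [ε] using h.const_mul 2
  have hae (n : ℕ) : ∀ᵐ x, |f x / θ - g n x| ≤ ε n := by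
    have h := hfg n
    rw [Measure.restrict_univ, eLpNorm_exponent_top] at h
    filter_upwards [ae_le_eLpNormEssSup (f := fun x => f x / θ - g n x) (μ := volume)] with x hx
    have hx' := hx.trans h.le
    rw [Real.enorm_eq_ofReal_abs] at hx'
    exact (ENNReal.ofReal_le_ofReal_iff (by positivity)).1 hx'
  -- The estimate between two continuous functions holds almost everywhere, hence everywhere.
  have hcauchy (n m : ℕ) (x : Fin d → ℝ) : |g n x - g m x| ≤ ε n + ε m := by
    have hdense : Dense {x | |g n x - g m x| ≤ ε n + ε m} := by
      refine Measure.dense_of_ae (μ := volume) ?_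
      filter_upwards [hae n, hae m] with x hx hy
      rw [abs_le] at *
      constructor <;> linarith
    have hclosed : IsClosed {x | |g n x - g m x| ≤ ε n + ε m} :=
      isClosed_le ((hgc n).sub (hgc m)).abs continuous_const
    exact hclosed.closure_subset (hdense x)
  have hu : UniformCauchySeqOn g Filter.atTop Set.univ := by
    rw [Metric.uniformCauchySeqOn_iff]
    intro δ hδ
    obtain ⟨M, hM⟩ := Filter.eventually_atTop.1 (hε.eventually_lt_const (half_pos hδ))
    refine ⟨M, fun m hm n hn x _ => ?_⟩
    rw [Real.dist_eq]
    linarith [hcauchy m n x, hM m hm, hM n hn]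
  choose G hG using fun x => cauchySeq_tendsto_of_complete (hu.cauchySeq (Set.mem_univ x))
  have hGu : TendstoUniformly g G Filter.atTop :=
    tendstoUniformlyOn_univ.1 (hu.tendstoUniformlyOn_of_tendsto fun x _ => hG x)
  refine ⟨fun x => θ * G x, continuous_const.mul
    (hGu.continuous (Filter.Frequently.of_forall hgc)), ?_⟩
  filter_upwards [ae_all_iff.2 hae] with x hx
  have hlim : Filter.Tendsto (fun n => g n x) Filter.atTop (nhds (f x / θ)) := by
    rw [tendsto_iff_dist_tendsto_zero]
    refine squeeze_zero (fun _ => dist_nonneg) (fun n => ?_) hε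
    rw [dist_comm, Real.dist_eq]
    exact hx n
  rw [← tendsto_nhds_unique hlim (hG x)]
  field_simp

/-! ### A lower bound for randomized sampling -/

section Sampling

variable {d : ℕ} {D : Set (Fin d → ℝ)}

/-- A method cannot tell a function that vanishes at all sample points from zero, so one of the two
is reconstructed badly. -/
theorem eLpNorm_le_add_of_forall_eq_zero {U : Set C(D, ℝ)} {p : ℝ≥0∞} (hp : 1 ≤ p)
    {f : U} {z : U} (hz : (z : C(D, ℝ)) = 0) {N : ℕ} {A : U → Lp ℝ p (leb D)} {x : Fin N → D}
    {Q : (Fin N → ℝ) → Lp ℝ p (leb D)} (hA : ∀ f : U, A f = Q fun i => (f : C(D, ℝ)) (x i))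
    (hf : ∀ i, (f : C(D, ℝ)) (x i) = 0) :
    eLpNorm (f : C(D, ℝ)) p (leb D) ≤
      eLpNorm (fun x => (f : C(D, ℝ)) x - A f x) p (leb D) +
        eLpNorm (fun x => (z : C(D, ℝ)) x - A z x) p (leb D) := by
  have hAz : A z = A f := by rw [hA, hA]; simp [hz, hf]
  have hm := (Lp.memLp (A f)).1
  have hfm : AEStronglyMeasurable (f : C(D, ℝ)) (leb D) :=
    (f : C(D, ℝ)).continuous.aestronglyMeasurable
  rw [hAz]
  calc _ = eLpNorm ((fun x => (f : C(D, ℝ)) x - A f x) - fun x => (z : C(D, ℝ)) x - A f x)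
        p (leb D) := by congr 1; funext x; simp [hz]
    _ ≤ _ := eLpNorm_sub_le (hfm.sub hm)
        ((z : C(D, ℝ)).continuous.aestronglyMeasurable.sub hm) hp

/-- If finitely many functions have disjoint supports, then `N` sample points can meet the support
of at most `N` of them; all the others are confused with zero. -/
theorem card_mul_le_sum_error {U : Set C(D, ℝ)} {p : ℝ≥0∞} (hp : 1 ≤ p) {ι : Type*} [Fintype ι]
    {f : ι → U} {z : U} (hz : (z : C(D, ℝ)) = 0)
    (hdisj : ∀ x i j, (f i : C(D, ℝ)) x ≠ 0 → (f j : C(D, ℝ)) x ≠ 0 → i = j)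
    {η : ℝ≥0∞} (hη : ∀ i, η ≤ eLpNorm (f i : C(D, ℝ)) p (leb D)) {N : ℕ}
    {A : U → Lp ℝ p (leb D)} (hA : IsDeterministicMethod U p N A) :
    (Fintype.card ι : ℝ≥0∞) * η ≤
      ∑ i, (eLpNorm (fun x => (f i : C(D, ℝ)) x - A (f i) x) p (leb D) +
        eLpNorm (fun x => (z : C(D, ℝ)) x - A z x) p (leb D)) + N * η := by
  classical
  obtain ⟨x, Q, hA⟩ := hA
  set E : ι → ℝ≥0∞ := fun i => eLpNorm (fun x => (f i : C(D, ℝ)) x - A (f i) x) p (leb D) +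
        eLpNorm (fun x => (z : C(D, ℝ)) x - A z x) p (leb D)
  set H : Finset ι := Finset.univ.filter fun i => ∃ k, (f i : C(D, ℝ)) (x k) ≠ 0
  have hH : H.card ≤ N := by
    choose k hk using fun i : H => (Finset.mem_filter.1 i.2).2
    have hinj : Function.Injective k := fun i j hij =>
      Subtype.ext (hdisj (x (k i)) i j (hk i) (by rw [hij]; exact hk j))
    simpa using Fintype.card_le_of_injective k hinj
  have hterm (i : ι) : η ≤ E i + if i ∈ H then η else 0 := by
    by_cases hi : i ∈ H
    · simp [hi]
    · simp only [H, Finset.mem_filter, Finset.mem_univ, true_and, not_exists, not_not] at hi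
      exact ((hη i).trans (eLpNorm_le_add_of_forall_eq_zero hp hz hA hi)).trans le_self_add
  calc (Fintype.card ι : ℝ≥0∞) * η = ∑ _i : ι, η := by simp
    _ ≤ ∑ i, (E i + if i ∈ H then η else 0) := Finset.sum_le_sum fun i _ => hterm i
    _ = ∑ i, E i + H.card * η := by simp [Finset.sum_add_distrib]
    _ ≤ _ := by gcongr

theorem RandomizedMethod.measurable_eLpNorm_sub [CompactSpace D] [IsFiniteMeasure (leb D)]
    {U : Set C(D, ℝ)} {p : ℝ≥0∞} [Fact (1 ≤ p)] {N : ℕ} (S : RandomizedMethod.{u} U p N) (f : U) :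
    letI := S.mΩ
    Measurable fun ω => eLpNorm (fun x : D => (f : C(D, ℝ)) x - S.A ω f x) p (leb D) := by
  let := S.mΩ
  let : MeasurableSpace (Lp ℝ p (leb D)) := borel _
  have : BorelSpace (Lp ℝ p (leb D)) := ⟨rfl⟩
  have hmem : MemLp (f : C(D, ℝ)) p (leb D) := (f : C(D, ℝ)).memLp (leb D) ℝ
  have h : (fun ω => eLpNorm (fun x : D => (f : C(D, ℝ)) x - S.A ω f x) p (leb D)) =
      fun ω => edist (hmem.toLp _) (S.A ω f) := by
    funext ω
    rw [Lp.edist_def]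
    refine eLpNorm_congr_ae ?_
    filter_upwards [hmem.coeFn_toLp] with x hx
    simp [hx]
  rw [h]
  exact (continuous_const.edist continuous_id).measurable.comp (S.measurable_apply f)

/-- **Lower bound by disjoint bumps.** If `U` contains zero and at least `2 * N` functions of
`L^p`-norm at least `η` with disjoint supports, then no method that uses `N` samples in expectation
has an error below `η / 4`. -/
theorem le_four_mul_optimalError [CompactSpace D] [IsFiniteMeasure (leb D)]
    {U : Set C(D, ℝ)} {p : ℝ≥0∞} [Fact (1 ≤ p)] (h0 : (0 : C(D, ℝ)) ∈ U) {ι : Type*} [Fintype ι]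
    {f : ι → C(D, ℝ)} (hf : ∀ i, f i ∈ U) (hdisj : ∀ x i j, f i x ≠ 0 → f j x ≠ 0 → i = j)
    {η : ℝ≥0∞} (hη_top : η ≠ ∞) (hη : ∀ i, η ≤ eLpNorm (f i) p (leb D)) {N : ℕ} (hN : 1 ≤ N)
    (hcard : 2 * N ≤ Fintype.card ι) : η ≤ 4 * optimalError.{u} U p N := by
  rw [optimalError, ENNReal.mul_iInf_of_ne (by norm_num) (by norm_num)]
  refine le_iInf fun S => ?_
  let := S.mΩ
  have := S.isProb
  let g : ι → U := fun i => ⟨f i, hf i⟩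
  let z : U := ⟨0, h0⟩
  obtain ⟨E, hE⟩ : ∃ E : U → S.Ω → ℝ≥0∞, E = fun (h : U) (ω : S.Ω) =>
    eLpNorm (fun x : D => (h : C(D, ℝ)) x - S.A ω h x) p (leb D) := ⟨_, rfl⟩
  have herr (h : U) : ∫⁻ ω, E h ω ∂S.P ≤ S.error := by
    rw [hE]
    exact le_iSup (fun h : ↥U =>
      ∫⁻ ω, eLpNorm (fun x : D => (h : C(D, ℝ)) x - S.A ω h x) p (leb D) ∂S.P) h
  have hmeas (h : U) : Measurable (E h) := by
    rw [hE]
    exact S.measurable_eLpNorm_sub h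
  have hpt (ω : S.Ω) : (Fintype.card ι : ℝ≥0∞) * η ≤
      ∑ i, (E (g i) ω + E z ω) + S.numSamples ω * η := by
    rw [hE]
    exact card_mul_le_sum_error (f := g) Fact.out rfl hdisj hη (S.deterministic ω)
  clear hE
  have hmN : Measurable fun ω => (S.numSamples ω : ℝ≥0∞) :=
    measurable_from_top.comp S.measurable_numSamples
  set K := Fintype.card ι
  have key : (K : ℝ≥0∞) * η ≤ K * (S.error + S.error) + N * η := by
    calc (K : ℝ≥0∞) * η = ∫⁻ _, (K : ℝ≥0∞) * η ∂S.P := by simp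
      _ ≤ ∫⁻ ω, (∑ i, (E (g i) ω + E z ω) + S.numSamples ω * η) ∂S.P := lintegral_mono hpt
      _ = ∑ i, (∫⁻ ω, E (g i) ω ∂S.P + ∫⁻ ω, E z ω ∂S.P) +
            (∫⁻ ω, (S.numSamples ω : ℝ≥0∞) ∂S.P) * η := by
          rw [lintegral_add_right _ (hmN.mul_const _), lintegral_mul_const _ hmN,
            lintegral_finsetSum (f := fun i ω => E (g i) ω + E z ω) _
              fun i _ => (hmeas (g i)).add (hmeas z)]
          simp only [lintegral_add_left (hmeas _)]
      _ ≤ ∑ _i : ι, (S.error + S.error) + N * η := by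
          gcongr
          · exact herr _
          · exact herr _
          · exact S.expected_numSamples
      _ = _ := by simp [K, mul_add]
  by_cases he : S.error = ∞
  · simp [he]
  lift η to ℝ≥0 using hη_top
  lift S.error to ℝ≥0 using he with e
  norm_cast at key ⊢
  rw [← NNReal.coe_le_coe] at key ⊢
  push_cast at key ⊢
  have hN' : (1 : ℝ) ≤ N := by exact_mod_cast hN
  have hK : (2 : ℝ) * N ≤ K := by exact_mod_cast hcard
  have h1 : (K : ℝ) * η ≤ K * (4 * e) := by nlinarith [η.2]
  exact le_of_mul_le_mul_left h1 (by linarith)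

end Sampling

/-! ### Spikes in the unit ball -/

/-- A function bounded by `κ ≤ 1` lies in the unit ball as soon as it is realized by a network with
`n` weights for every `n` that is too large for the bound `κ` alone to give the rate `n ^ (-α)`. -/
theorem mem_unitBall_of_abs_le {d : ℕ} {l : ℕ+ → ℕ∞} (hl : ∀ n, 1 ≤ l n) {α κ : ℝ}
    {f : (Fin d → ℝ) → ℝ} (hf : Continuous f) (hκ : κ ≤ 1) (hfκ : ∀ x, |f x| ≤ κ)
    (h : ∀ n : ℕ+, ((n : ℕ) : ℝ) ^ α * κ ≤ 1 ∨ f ∈ netClass d l n) :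
    f ∈ unitBall l α ∞ Set.univ := by
  have hnorm : eLpNorm f ∞ (volume.restrict Set.univ) ≤ ENNReal.ofReal κ := by
    rw [eLpNorm_exponent_top]
    exact eLpNormEssSup_le_of_ae_bound (.of_forall hfκ)
  refine ⟨memLp_top_of_bound hf.aestronglyMeasurable κ (.of_forall hfκ), ?_⟩
  refine iInf_le_of_le 1 (iInf_le_of_le one_pos (iInf_le_of_le ?_ (by simp)))
  simp only [NNReal.coe_one, div_one]
  refine max_le (hnorm.trans (by simpa using hκ)) (iSup_le fun n => ?_)
  rcases h n with h | h
  · have hn : (0 : ℝ) < (n : ℕ) := by exact_mod_cast n.pos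
    calc ((n : ℕ) : ℝ≥0∞) ^ α * lpDist ∞ Set.univ f (netClass d l n)
        ≤ ENNReal.ofReal (((n : ℕ) : ℝ) ^ α) * ENNReal.ofReal κ := by
          gcongr
          · rw [← ENNReal.ofReal_rpow_of_pos hn, ENNReal.ofReal_natCast]
          · refine (iInf₂_le (fun _ => 0) (zero_mem_netClass (hl n))).trans ?_
            simpa using hnorm
      _ ≤ 1 := by
          rw [← ENNReal.ofReal_mul (by positivity)]
          simpa using h
  · have h0 : lpDist ∞ Set.univ f (netClass d l n) = 0 :=
      le_antisymm ((iInf₂_le f h).trans (by simp only [sub_self, eLpNorm_zero', le_refl])) bot_le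
    rw [h0, mul_zero]
    exact zero_le_one

theorem continuous_spike {d : ℕ} (κ s : ℝ) (y : Fin d → ℝ) : Continuous (spike κ s y) := by
  unfold spike
  fun_prop

theorem spike_nonneg {d : ℕ} (κ s : ℝ) (y x : Fin d → ℝ) : 0 ≤ spike κ s y x := le_max_left _ _

theorem spike_le {d : ℕ} {κ s : ℝ} (hκ : 0 ≤ κ) (hs : 0 ≤ s) (y x : Fin d → ℝ) :
    spike κ s y x ≤ κ :=
  max_le hκ (sub_le_self _ (mul_nonneg hs (Finset.sum_nonneg fun _ _ => abs_nonneg _)))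

theorem mul_sum_lt_of_spike_ne_zero {d : ℕ} {κ s : ℝ} {y x : Fin d → ℝ} (h : spike κ s y x ≠ 0) :
    s * ∑ i, |x i - y i| < κ := by
  by_contra hle
  exact h (max_eq_left (by linarith))

/-- The spike as a continuous function on the cube. -/
noncomputable def cubeSpike {d : ℕ} (κ s : ℝ) (y : Fin d → ℝ) : C(cube d, ℝ) :=
  ⟨fun x => spike κ s y x, (continuous_spike κ s y).comp continuous_subtype_val⟩

theorem zero_mem_restrictedBall {d : ℕ} {l : ℕ+ → ℕ∞} (hl : ∀ n, 1 ≤ l n) (α : ℝ) :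
    (0 : C(cube d, ℝ)) ∈ restrictedBall d l α :=
  ⟨fun _ => 0, mem_unitBall_of_abs_le hl continuous_const zero_le_one (by simp)
    fun n => .inr (zero_mem_netClass (hl n)), .of_forall fun _ => rfl⟩

theorem cubeSpike_mem_restrictedBall {d n j : ℕ} {l : ℕ+ → ℕ∞} (hl : ∀ n, 1 ≤ l n) {α κ : ℝ}
    (hα : 0 < α) (hn : 0 < n) (h₀ : 0 ≤ κ) (h₁ : κ ≤ 1)
    (hκ : ((6 * d + 2 * (j + 1) : ℕ) * n : ℝ) ^ α * κ ≤ 1)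
    (hdepth : ∀ m : ℕ+, n ≤ m → ((max 3 (2 * (j + 1)) : ℕ) : ℕ∞) ≤ l m)
    {y : Fin d → ℝ} (hy : y ∈ cube d) :
    cubeSpike κ (n ^ (j + 1)) y ∈ restrictedBall d l α := by
  refine ⟨spike κ (n ^ (j + 1)) y, mem_unitBall_of_abs_le hl (continuous_spike _ _ _) h₁
    (fun x => ?_) fun m => ?_, .of_forall fun _ => rfl⟩
  · rw [abs_of_nonneg (spike_nonneg _ _ _ _)]
    exact spike_le h₀ (by positivity) _ _
  rcases le_total ((6 * d + 2 * (j + 1)) * n) (m : ℕ) with hm | hm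
  · exact .inr (spike_mem_netClass hn h₀ h₁ hy hm (hdepth m (by nlinarith)))
  · refine .inl (le_trans ?_ hκ)
    gcongr
    exact_mod_cast hm

/-- The centre of the cell with index `a` in the partition of the cube into `m ^ d` equal cubes. -/
noncomputable def cellCentre {d m : ℕ} (a : Fin d → Fin m) : Fin d → ℝ :=
  fun i => (2 * (a i : ℕ) + 1) / (2 * m)

theorem cellCentre_mem {d m : ℕ} (a : Fin d → Fin m) (i : Fin d) :
    1 / (2 * m : ℝ) ≤ cellCentre a i ∧ cellCentre a i ≤ 1 - 1 / (2 * m) := by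
  have hlt : ((a i : ℕ) : ℝ) + 1 ≤ m := by exact_mod_cast (a i).isLt
  have h0 : (0 : ℝ) ≤ (a i : ℕ) := by positivity
  have hm : (0 : ℝ) < 2 * m := by linarith
  unfold cellCentre
  constructor
  · gcongr
    linarith
  · rw [div_le_iff₀ hm, sub_mul, div_mul_cancel₀ _ hm.ne']
    linarith

theorem cellCentre_mem_cube {d m : ℕ} (a : Fin d → Fin m) : cellCentre a ∈ cube d := by
  have h : (0 : ℝ) ≤ 1 / (2 * m) := by positivity
  exact ⟨fun i => h.trans (cellCentre_mem a i).1,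
    fun i => (cellCentre_mem a i).2.trans (sub_le_self _ h)⟩

theorem eq_of_spike_cellCentre_ne_zero {d m : ℕ} {κ s : ℝ} (hs : 0 ≤ s) (hκs : 2 * κ * m ≤ s)
    {a b : Fin d → Fin m} {x : Fin d → ℝ} (ha : spike κ s (cellCentre a) x ≠ 0)
    (hb : spike κ s (cellCentre b) x ≠ 0) : a = b := by
  by_contra hab
  obtain ⟨i, hi⟩ := Function.ne_iff.1 hab
  have hm : (0 : ℝ) < m := by exact_mod_cast (Nat.zero_le _).trans_lt (a i).isLt
  have hsep : 1 / (m : ℝ) ≤ |cellCentre a i - cellCentre b i| := by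
    have h : cellCentre a i - cellCentre b i = (((a i : ℕ) : ℤ) - ((b i : ℕ) : ℤ) : ℤ) / m := by
      unfold cellCentre
      push_cast
      field_simp
      ring
    rw [h, abs_div, abs_of_pos hm]
    gcongr
    have hne : ((a i : ℕ) : ℤ) - ((b i : ℕ) : ℤ) ≠ 0 := by
      rw [sub_ne_zero]
      exact_mod_cast fun h => hi (Fin.ext h)
    exact_mod_cast Int.one_le_abs hne
  have htri : |cellCentre a i - cellCentre b i| ≤
      |x i - cellCentre a i| + |x i - cellCentre b i| := by
    rw [abs_sub_comm (x i) (cellCentre a i)]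
    exact abs_sub_le _ _ _
  have hle (c : Fin d → Fin m) : |x i - cellCentre c i| ≤ ∑ i, |x i - cellCentre c i| :=
    Finset.single_le_sum (f := fun i => |x i - cellCentre c i|) (fun _ _ => abs_nonneg _)
      (Finset.mem_univ i)
  have h₁ := mul_sum_lt_of_spike_ne_zero ha
  have h₂ := mul_sum_lt_of_spike_ne_zero hb
  have h₃ : s * (1 / m) ≤ s * (∑ i, |x i - cellCentre a i| + ∑ i, |x i - cellCentre b i|) := by
    gcongr
    linarith [hle a, hle b]
  have h₄ : 2 * κ ≤ s * (1 / m) := by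
    rw [mul_one_div, le_div_iff₀ hm]
    exact hκs
  linarith

instance isFiniteMeasure_leb_cube (d : ℕ) : IsFiniteMeasure (leb (cube d)) := by
  refine ⟨?_⟩
  rw [comap_subtype_coe_apply measurableSet_Icc]
  simp only [Set.image_univ, Subtype.range_coe]
  exact isCompact_Icc.measure_lt_top

/-- A spike is at least half as high as its peak on a cube of side length `κ / (d * s)`. -/
theorem le_eLpNorm_cubeSpike {d m : ℕ} (hd : 1 ≤ d) {κ s : ℝ} (hκ : 0 < κ) (hs : 0 < s)
    (hm : 1 ≤ m) (hκs : 2 * κ * m ≤ s) (a : Fin d → Fin m) {p : ℝ≥0∞} (hp : 1 ≤ p) :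
    ENNReal.ofReal (κ / 2 * ((κ / (d * s)) ^ d) ^ (1 / p.toReal)) ≤
      eLpNorm (cubeSpike κ s (cellCentre a)) p (leb (cube d)) := by
  have hd' : (1 : ℝ) ≤ d := by exact_mod_cast hd
  have hm' : (1 : ℝ) ≤ m := by exact_mod_cast hm
  set r : ℝ := κ / (2 * d * s)
  have hr : 0 < r := by positivity
  have hrm : r ≤ 1 / (2 * m) := by
    rw [div_le_div_iff₀ (by positivity) (by positivity)]
    nlinarith
  set B := Metric.closedBall (cellCentre a) r
  have hB : B ⊆ cube d := by
    intro x hx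
    rw [Metric.mem_closedBall, dist_pi_le_iff hr.le] at hx
    refine ⟨fun i => ?_, fun i => ?_⟩ <;>
    · have h := hx i
      have h' := cellCentre_mem a i
      rw [Real.dist_eq, abs_le] at h
      simp only [Pi.zero_apply, Pi.one_apply]
      linarith
  have hspike : ∀ x ∈ B, κ / 2 ≤ spike κ s (cellCentre a) x := by
    intro x hx
    rw [Metric.mem_closedBall, dist_pi_le_iff hr.le] at hx
    have h : ∑ i, |x i - cellCentre a i| ≤ d * r := by
      simpa using Finset.sum_le_card_nsmul Finset.univ (fun i => |x i - cellCentre a i|) r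
        fun i _ => hx i
    have h' : s * (d * r) = κ / 2 := by
      simp only [r]
      field_simp
    have h'' := mul_le_mul_of_nonneg_left h hs.le
    exact le_trans (by linarith) (le_max_right _ _)
  have hBm : MeasurableSet (Subtype.val ⁻¹' B : Set (cube d)) :=
    measurable_subtype_coe Metric.isClosed_closedBall.measurableSet
  have hvol : leb (cube d) (Subtype.val ⁻¹' B) = ENNReal.ofReal ((κ / (d * s)) ^ d) := by
    rw [comap_subtype_coe_apply measurableSet_Icc, Subtype.image_preimage_coe,
      Set.inter_eq_right.2 hB, Real.volume_pi_closedBall _ hr.le, Fintype.card_fin]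
    congr 2
    simp only [r]
    field_simp
  calc ENNReal.ofReal (κ / 2 * ((κ / (d * s)) ^ d) ^ (1 / p.toReal))
      = ‖κ / 2‖ₑ * (leb (cube d) (Subtype.val ⁻¹' B)) ^ (1 / p.toReal) := by
        rw [hvol, ENNReal.ofReal_rpow_of_nonneg (by positivity) (by positivity),
          ENNReal.ofReal_mul (by positivity), Real.enorm_eq_ofReal (by positivity)]
    _ = eLpNorm ((Subtype.val ⁻¹' B).indicator fun _ => κ / 2) p (leb (cube d)) := by
        refine (eLpNorm_indicator_const' hBm ?_ (zero_lt_one.trans_le hp).ne').symm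
        rw [hvol]
        simpa using by positivity
    _ ≤ _ := by
        refine eLpNorm_mono_real fun x => ?_
        by_cases hx : (x : Fin d → ℝ) ∈ B
        · rw [Set.indicator_of_mem (by exact hx), Real.norm_of_nonneg (by positivity)]
          exact hspike x hx
        · rw [Set.indicator_of_notMem (by exact hx), norm_zero]
          exact spike_nonneg _ _ _ _

/-! ### Rates of decay -/

/-- Spikes centred in the `m ^ d` cells of the cube, with slope large enough to make their
supports disjoint, bound the optimal error from below. -/
theorem spike_norm_le_optimalError {p : ℝ≥0∞} [Fact (1 ≤ p)] {d : ℕ} (hd : 1 ≤ d)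
    {l : ℕ+ → ℕ∞} (hl : ∀ n, 1 ≤ l n) {α : ℝ} (hα : 0 < α) {n j : ℕ} (hn : 0 < n)
    (hdepth : ∀ m : ℕ+, n ≤ m → ((max 3 (2 * (j + 1)) : ℕ) : ℕ∞) ≤ l m)
    {κ : ℝ} (h₀ : 0 < κ) (h₁ : κ ≤ 1)
    (hκ : ((6 * d + 2 * (j + 1) : ℕ) * n : ℝ) ^ α * κ ≤ 1)
    {m : ℕ} (hm : 1 ≤ m) (hκm : 2 * κ * m ≤ n ^ (j + 1)) {N : ℕ} (hN : 1 ≤ N)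
    (hNm : 2 * N ≤ m ^ d) :
    ENNReal.ofReal (κ / 2 * ((κ / (d * n ^ (j + 1))) ^ d) ^ (1 / p.toReal)) ≤
      4 * optimalError.{u} (restrictedBall d l α) p N := by
  have hs : (0 : ℝ) < n ^ (j + 1) := by positivity
  exact le_four_mul_optimalError (ι := Fin d → Fin m) (zero_mem_restrictedBall hl α)
    (fun a => cubeSpike_mem_restrictedBall hl hα hn h₀.le h₁ hκ hdepth (cellCentre_mem_cube a))
    (fun x a b => eq_of_spike_cellCentre_ne_zero hs.le hκm) ENNReal.ofReal_ne_top
    (fun a => le_eLpNorm_cubeSpike hd h₀ hs hm hκm a Fact.out) hN (by simpa using hNm)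

theorem exponent_le_of_eventually_rpow_le {a b u v : ℝ} (ha : 0 < a)
    (h : ∀ᶠ n : ℕ in Filter.atTop, a * (n : ℝ) ^ u ≤ b * (n : ℝ) ^ v) : u ≤ v := by
  by_contra! hvu
  have hlim : Filter.Tendsto (fun n : ℕ => b * (n : ℝ) ^ (-(u - v))) Filter.atTop (nhds (b * 0)) :=
    ((tendsto_rpow_neg_atTop (sub_pos.2 hvu)).comp tendsto_natCast_atTop_atTop).const_mul b
  rw [mul_zero] at hlim
  have hle : a ≤ 0 := by
    refine ge_of_tendsto hlim ?_
    filter_upwards [h, Filter.eventually_gt_atTop 0] with n hn hn0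
    have hx : (0 : ℝ) < n := by exact_mod_cast hn0
    rw [neg_sub, Real.rpow_sub hx, ← mul_div_assoc, le_div_iff₀ (by positivity)]
    exact hn
  linarith

/-- The bound on the order that comes from networks of depth `max 3 (2 * k)`, for `k = j + 1`. -/
theorem order_le_of_depth {p : ℝ≥0∞} [Fact (1 ≤ p)] {d : ℕ} (hd : 1 ≤ d)
    {l : ℕ+ → ℕ∞} (hl : ∀ n, 1 ≤ l n) (hmono : Monotone l) {α : ℝ} (hα : 0 < α) {j : ℕ}
    {n₀ : ℕ+} (hdepth : ((max 3 (2 * (j + 1)) : ℕ) : ℕ∞) ≤ l n₀) {β : ℝ} (hβ : 0 ≤ β)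
    {C : ℝ≥0} (hC : ∀ N : ℕ, 1 ≤ N →
      optimalError.{u} (restrictedBall d l α) p N ≤ (C : ℝ≥0∞) * (N : ℝ≥0∞) ^ (-β)) :
    β ≤ 1 / p.toReal + 1 / d * (α / (α + (j + 1 : ℕ))) := by
  have hd' : (0 : ℝ) < d := by exact_mod_cast hd
  set q : ℝ := 1 / p.toReal
  set k : ℕ := j + 1 with hk
  set c : ℝ := ((6 * d + 2 * (j + 1) : ℕ) : ℝ) with hc
  have hc1 : 1 ≤ c := by
    rw [hc]
    exact_mod_cast (by omega : 1 ≤ 6 * d + 2 * (j + 1))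
  have hc0 : 0 < c := by linarith
  -- The height of the spikes is `κ = (c * n) ^ (-α)`; their slope is `n ^ k`, so that `κ / n ^ k`
  -- is a multiple of `n ^ (-(α + k))`, and the number of samples is chosen of order
  -- `n ^ (d * (α + k))`.
  have hρ : Filter.Tendsto (fun n : ℕ => c ^ α * (n : ℝ) ^ (α + k)) Filter.atTop Filter.atTop :=
    ((tendsto_rpow_atTop (by positivity)).comp tendsto_natCast_atTop_atTop).const_mul_atTop
      (by positivity)
  have key : ∀ᶠ n : ℕ in Filter.atTop,
      (c ^ (-α) / 2 * (c ^ (-α) / d) ^ (d * q)) * (n : ℝ) ^ (-α + -(α + k) * (d * q)) ≤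
        (4 * C * ((c ^ α / 4) ^ d / 4) ^ (-β)) * (n : ℝ) ^ ((α + k) * d * -β) := by
    filter_upwards [hρ.eventually_ge_atTop 4, Filter.eventually_ge_atTop (n₀ : ℕ)] with n hn4 hn
    have hn0 : 0 < n := n₀.pos.trans_le hn
    have hx : (0 : ℝ) < n := by exact_mod_cast hn0
    have hx1 : (1 : ℝ) ≤ n := by exact_mod_cast hn0
    set ρ : ℝ := c ^ α * (n : ℝ) ^ (α + k) with hρ_def
    set κ : ℝ := (c * n) ^ (-α) with hκ_def
    have hκ0 : 0 < κ := by positivity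
    have hκ_eq : κ = c ^ (-α) * (n : ℝ) ^ (-α) := Real.mul_rpow hc0.le hx.le
    have hκρ : κ * ρ = n ^ k := by
      rw [hκ_eq, hρ_def, Real.rpow_add hx, Real.rpow_neg hc0.le, Real.rpow_neg hx.le,
        Real.rpow_natCast]
      have h1 : c ^ α ≠ 0 := by positivity
      have h2 : (n : ℝ) ^ α ≠ 0 := by positivity
      field_simp
    have hκ1 : κ ≤ 1 :=
      Real.rpow_le_one_of_one_le_of_nonpos (one_le_mul_of_one_le_of_one_le hc1 hx1) (by linarith)
    set m : ℕ := ⌊ρ / 2⌋₊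
    have hmle : (m : ℝ) ≤ ρ / 2 := Nat.floor_le (by positivity)
    have hmge : ρ / 4 ≤ m := by
      have := Nat.lt_floor_add_one (ρ / 2)
      linarith
    have hm2 : 2 ≤ m := Nat.le_floor (by push_cast; linarith)
    have hmd : 2 ≤ m ^ d := hm2.trans (Nat.le_self_pow (by omega) m)
    set N : ℕ := m ^ d / 2
    have hN : 1 ≤ N := by omega
    have hN4 : (ρ / 4) ^ d / 4 ≤ (N : ℝ) := by
      have h1 : (ρ / 4) ^ d ≤ (m : ℝ) ^ d := by gcongr
      have h2 : (m : ℝ) ^ d ≤ 4 * N := by exact_mod_cast (by omega : m ^ d ≤ 4 * N)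
      linarith
    have hbound := (spike_norm_le_optimalError (p := p) hd hl hα hn0
      (fun i hi => hdepth.trans (hmono (by exact_mod_cast hn.trans hi))) hκ0 hκ1
      (by rw [hκ_def, ← hc, ← Real.rpow_add (by positivity)]; simp) (by omega)
      (by rw [← hκρ]; nlinarith) hN (Nat.mul_div_le _ _)).trans (mul_le_mul_right (hC N hN) 4)
    have hNpos : (0 : ℝ) < N := by exact_mod_cast hN
    have hR : (4 : ℝ≥0∞) * ((C : ℝ≥0∞) * (N : ℝ≥0∞) ^ (-β)) =
        ENNReal.ofReal (4 * C * (N : ℝ) ^ (-β)) := by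
      rw [ENNReal.ofReal_mul (by positivity), ENNReal.ofReal_mul (by positivity),
        ← ENNReal.ofReal_rpow_of_pos hNpos, ENNReal.ofReal_natCast, ENNReal.ofReal_coe_nnreal,
        mul_assoc]
      norm_num
    rw [hR, ENNReal.ofReal_le_ofReal_iff (by positivity)] at hbound
    have hNβ : (N : ℝ) ^ (-β) ≤ ((ρ / 4) ^ d / 4) ^ (-β) :=
      Real.rpow_le_rpow_of_nonpos (by positivity) hN4 (by linarith)
    have hL : κ / 2 * ((κ / (d * n ^ k)) ^ d) ^ q =
        (c ^ (-α) / 2 * (c ^ (-α) / d) ^ (d * q)) * (n : ℝ) ^ (-α + -(α + k) * (d * q)) := by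
      have h1 : κ / (d * n ^ k) = c ^ (-α) / d * (n : ℝ) ^ (-(α + k)) := by
        rw [hκ_eq, neg_add, Real.rpow_add hx, Real.rpow_neg hx.le k, Real.rpow_natCast]
        field_simp
      rw [h1, ← Real.rpow_natCast, ← Real.rpow_mul (by positivity),
        Real.mul_rpow (by positivity) (by positivity), ← Real.rpow_mul hx.le, hκ_eq,
        Real.rpow_add hx]
      ring
    have hRρ : ((ρ / 4) ^ d / 4) ^ (-β) =
        ((c ^ α / 4) ^ d / 4) ^ (-β) * (n : ℝ) ^ ((α + k) * d * -β) := by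
      have h1 : (ρ / 4) ^ d / 4 = (c ^ α / 4) ^ d / 4 * (n : ℝ) ^ ((α + k) * d) := by
        rw [hρ_def, Real.rpow_mul hx.le, Real.rpow_natCast]
        ring
      rw [h1, Real.mul_rpow (by positivity) (by positivity), ← Real.rpow_mul hx.le]
    calc _ = κ / 2 * ((κ / (d * n ^ k)) ^ d) ^ q := hL.symm
      _ ≤ 4 * C * (N : ℝ) ^ (-β) := hbound
      _ ≤ 4 * C * ((ρ / 4) ^ d / 4) ^ (-β) := by gcongr
      _ = _ := by rw [hRρ]; ring
  have hexp := exponent_le_of_eventually_rpow_le (by positivity) key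
  have hsum : 0 < α + (k : ℝ) := by positivity
  rw [← sub_nonneg] at hexp ⊢
  have hfac : q + 1 / d * (α / (α + k)) - β =
      ((α + k) * d * -β - (-α + -(α + k) * (d * q))) / ((α + k) * d) := by
    field_simp
    ring
  rw [hfac]
  exact div_nonneg hexp (by positivity)

theorem coe_le_ennreal_rate {p : ℝ≥0∞} (hp : 1 ≤ p) {d k : ℕ} (hd : 1 ≤ d) {α : ℝ} (hα : 0 < α)
    {β : ℝ≥0} (h : (β : ℝ) ≤ 1 / p.toReal + 1 / d * (α / (α + k))) :
    (β : ℝ≥0∞) ≤ p⁻¹ + (d : ℝ≥0∞)⁻¹ * (ENNReal.ofReal α / (ENNReal.ofReal α + k)) := by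
  have hd' : (0 : ℝ) < d := by exact_mod_cast hd
  have hp' : p⁻¹ = ENNReal.ofReal (1 / p.toReal) := by
    rw [one_div, ← ENNReal.toReal_inv, ENNReal.ofReal_toReal]
    exact ENNReal.inv_ne_top.2 (zero_lt_one.trans_le hp).ne'
  rw [hp', ← ENNReal.ofReal_natCast d, ← ENNReal.ofReal_natCast k,
    ← ENNReal.ofReal_inv_of_pos hd', ← ENNReal.ofReal_add hα.le (by positivity),
    ← ENNReal.ofReal_div_of_pos (by positivity), ← ENNReal.ofReal_mul (by positivity),
    ← ENNReal.ofReal_add (by positivity) (by positivity), ← one_div,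
    ← ENNReal.ofReal_coe_nnreal]
  exact ENNReal.ofReal_le_ofReal h

end SamplingGap

theorem mainTheorem1 (p : ENNReal) [Fact (1 ≤ p)] (d : ℕ) (hd : 1 ≤ d)
    (l : ℕ+ → ℕ∞) (hl_pos : ∀ n, 1 ≤ l n) (hl_mono : Monotone l) (hl_sup : 3 ≤ ⨆ n, l n)
    (α : ℝ) (hα : 0 < α) :
    (∀ f ∈ SamplingGap.unitBall l α ⊤ (Set.univ : Set (Fin d → ℝ)),
      ∃ h : C(SamplingGap.cube d, ℝ),
        ∀ᵐ x ∂SamplingGap.leb (SamplingGap.cube d), h x = f (x : Fin d → ℝ)) ∧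
    SamplingGap.optimalOrder.{u} (SamplingGap.restrictedBall d l α) p ≤
      p⁻¹ + (d : ENNReal)⁻¹ *
        (ENNReal.ofReal α / (ENNReal.ofReal α + SamplingGap.halfFloor (⨆ n, l n))) := by
  refine ⟨fun f hf => ?_, iSup₂_le fun β hβ => ?_⟩
  · obtain ⟨g, hg, hfg⟩ := SamplingGap.exists_continuous_ae_eq_of_mem_unitBall hα hf
    exact ⟨⟨fun x => g x, hg.comp continuous_subtype_val⟩,
      SamplingGap.ae_leb_of_ae measurableSet_Icc (hfg.mono fun x hx => hx.symm)⟩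
  obtain ⟨C, -, hC⟩ := hβ
  have hrate (j : ℕ) (n₀ : ℕ+) (h : ((max 3 (2 * (j + 1)) : ℕ) : ℕ∞) ≤ l n₀) :
      (β : ℝ≥0∞) ≤ p⁻¹ + (d : ℝ≥0∞)⁻¹ *
        (ENNReal.ofReal α / (ENNReal.ofReal α + (j + 1 : ℕ))) :=
    SamplingGap.coe_le_ennreal_rate Fact.out hd hα
      (SamplingGap.order_le_of_depth hd hl_pos hl_mono hα h β.2 hC)
  by_cases htop : ⨆ n, l n = ⊤
  · -- Depths are unbounded: let the number of amplification steps tend to infinity.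
    have hlim : Filter.Tendsto (fun j : ℕ => p⁻¹ + (d : ℝ≥0∞)⁻¹ *
        (ENNReal.ofReal α / (ENNReal.ofReal α + (j + 1 : ℕ)))) Filter.atTop
        (nhds (p⁻¹ + (d : ℝ≥0∞)⁻¹ * (ENNReal.ofReal α / (ENNReal.ofReal α + ⊤)))) := by
      have hj : Filter.Tendsto (fun j : ℕ => ((j + 1 : ℕ) : ℝ≥0∞)) Filter.atTop (nhds ⊤) :=
        ENNReal.tendsto_nat_nhds_top.comp (Filter.tendsto_add_atTop_nat 1)
      refine tendsto_const_nhds.add (ENNReal.Tendsto.const_mul ?_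
        (.inr (ENNReal.inv_ne_top.2 (by exact_mod_cast (by omega : d ≠ 0)))))
      exact ENNReal.Tendsto.const_div (tendsto_const_nhds.add hj) (.inr ENNReal.ofReal_ne_top)
    rw [SamplingGap.halfFloor, if_pos htop]
    refine ge_of_tendsto hlim (.of_forall fun j => ?_)
    have hlt : ((max 3 (2 * (j + 1)) : ℕ) : ℕ∞) < ⨆ n, l n := htop ▸ ENat.natCast_lt_top _
    obtain ⟨n₀, h⟩ := lt_iSup_iff.1 hlt
    exact hrate j n₀ h.le
  · obtain ⟨L, hL⟩ := ENat.ne_top_iff_exists.1 htop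
    rw [← hL] at hl_sup
    have hL3 : 3 ≤ L := by exact_mod_cast hl_sup
    have hlt : ((L - 1 : ℕ) : ℕ∞) < ⨆ n, l n := by
      rw [← hL]
      exact_mod_cast (by omega : L - 1 < L)
    obtain ⟨n₀, h⟩ := lt_iSup_iff.1 hlt
    have hn₀ : (L : ℕ∞) ≤ l n₀ := by
      have := Order.add_one_le_of_lt h
      rwa [← Nat.cast_add_one, Nat.sub_add_cancel (by omega)] at this
    have := hrate (L / 2 - 1) n₀ (le_trans (by exact_mod_cast (by omega)) hn₀)
    rw [SamplingGap.halfFloor, if_neg htop, ← hL, ENat.toNat_natCast]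
    rwa [Nat.sub_add_cancel (by omega)] at this
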